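/- Let $\Sigma$ be a closed connected orientable smooth surface and let $\varepsilon>0$. Then there exist a magnetic Lagrangian $L_\varepsilon:T\Sigma\to\mathbb R$, $L_\varepsilon(q,v)=\tfrac12\|v\|_q^2+\theta_q(v)$ (with $\|\cdot\|$ the norm of a smooth Riemannian metric $g$ on $\Sigma$ and $\theta$ a smooth 1-form on $\Sigma$), and closed connected embedded submanifolds $Q_0,Q_1\subseteq\Sigma$ with $Q_0\cap Q_1\neq\emptyset$, such that the Mañé critical value of the universal cover satisfies $c_u(L_\varepsilon)\in[\tfrac12-\varepsilon,\tfrac12]$ and such that for every $k<\tfrac12-\varepsilon$ there is no Euler–Lagrange orbit $\gamma:[0,T]\to\Sigma$ of $L_\varepsilon$, $T>0$, of energy $k$ satisfying the conormal boundary conditions $$\gamma(0)\in Q_0,\quad \gamma(T)\in Q_1,\quad d_vL_\varepsilon(\gamma(0),\dot\gamma(0))\big|_{T_{\gamma(0)}Q_0}=0,\quad d_vL_\varepsilon(\gamma(T),\dot\gamma(T))\big|_{T_{\gamma(T)}Q_1}=0 .$$ Here the energy is $E(q,v)=d_vL_\varepsilon(q,v)[v]-L_\varepsilon(q,v)=\tfrac12\|v\|_q^2$,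 where $d_v$ is the fibrewise differential, and $c_u(L)$ is the infimum of all $k\in\mathbb R$ such that $\int_0^T\big(L(\gamma,\dot\gamma)+k\big)\,dt\ge 0$ for every $T>0$ and every closed contractible loop $\gamma:[0,T]\to\Sigma$ of Sobolev class $H^1$. -/

import Mathlib

open Set MeasureTheory
open scoped Manifold ContDiff Topology Bundle

noncomputable section

namespace MagneticOrbits

/-! ### Orientability and submanifolds

Manifolds are smooth and without boundary, modelled on Euclidean space `ℝⁿ`. -/

/-- A smooth `n`-manifold is orientable if it is covered by a family of smooth charts all of whose
coordinate changes have positive Jacobian determinant. -/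
def IsOrientable (n : ℕ) (M : Type*) [TopologicalSpace M]
    [ChartedSpace (EuclideanSpace ℝ (Fin n)) M] : Prop :=
  ∃ A : Set (OpenPartialHomeomorph M (EuclideanSpace ℝ (Fin n))),
    A ⊆ IsManifold.maximalAtlas (𝓡 n) ∞ M ∧
    (∀ q : M, ∃ φ ∈ A, q ∈ φ.source) ∧
    ∀ φ ∈ A, ∀ ψ ∈ A, ∀ q ∈ φ.source ∩ ψ.source,
      0 < (fderiv ℝ (fun x => ψ (φ.symm x)) (φ q)).det

section

variable {n : ℕ} {M : Type*} [TopologicalSpace M] [ChartedSpace (EuclideanSpace ℝ (Fin n)) M]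

/-- `Q ⊆ M` is an embedded smooth submanifold of dimension `d`: around each of its points there is
a smooth chart of `M` in which `Q` is a `d`-dimensional linear subspace. -/
def IsSubmanifold (n : ℕ) {M : Type*} [TopologicalSpace M]
    [ChartedSpace (EuclideanSpace ℝ (Fin n)) M] (d : ℕ) (Q : Set M) : Prop :=
  ∀ q ∈ Q, ∃ φ ∈ IsManifold.maximalAtlas (𝓡 n) ∞ M, q ∈ φ.source ∧
    ∃ W : Submodule ℝ (EuclideanSpace ℝ (Fin n)), Module.finrank ℝ W = d ∧
      ∀ x ∈ φ.source, x ∈ Q ↔ φ x ∈ W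

/-- A closed (that is, compact and without boundary) connected non-empty embedded submanifold. -/
def IsClosedConnectedSubmanifold (n : ℕ) {M : Type*} [TopologicalSpace M]
    [ChartedSpace (EuclideanSpace ℝ (Fin n)) M] (Q : Set M) : Prop :=
  IsCompact Q ∧ IsConnected Q ∧ ∃ d : ℕ, IsSubmanifold n d Q

/-- The tangent space of `Q ⊆ M` at `q`: the velocities at `q` of smooth curves in `Q`. -/
def tangentVectors (Q : Set M) (q : M) : Set (TangentSpace (𝓡 n) q) :=
  {v | ∃ c : ℝ → M, ContMDiffAt 𝓘(ℝ, ℝ) (𝓡 n) ∞ c 0 ∧ (∀ᶠ s in 𝓝 (0 : ℝ), c s ∈ Q) ∧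
    (⟨c 0, mfderiv 𝓘(ℝ, ℝ) (𝓡 n) c 0 (1 : ℝ)⟩ : TangentBundle (𝓡 n) M) = ⟨q, v⟩}

/-! ### Lagrangians -/

/-- A magnetic Lagrangian `L(q,v) = ½ ‖v‖_q² + θ_q(v)`, for some smooth Riemannian metric `g` on `M`
with norm `‖·‖` and some smooth 1-form `θ` on `M`. -/
def IsMagneticLagrangian [IsManifold (𝓡 n) ∞ M] (L : TangentBundle (𝓡 n) M → ℝ) : Prop :=
  ∃ (g : Bundle.ContMDiffRiemannianMetric (𝓡 n) ∞ (EuclideanSpace ℝ (Fin n))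
      (fun q : M => TangentSpace (𝓡 n) q))
    (θ : Cₛ^∞⟮𝓡 n; EuclideanSpace ℝ (Fin n) →L[ℝ] ℝ,
      fun q : M => TangentSpace (𝓡 n) q →L[ℝ] ℝ⟯),
    ∀ (q : M) (v : TangentSpace (𝓡 n) q), L ⟨q, v⟩ = 1 / 2 * g.inner q v v + θ q v

/-- The fibrewise differential `d_v L(q,v)`. -/
def fiberDeriv (L : TangentBundle (𝓡 n) M → ℝ) (q : M) (v : TangentSpace (𝓡 n) q) :
    TangentSpace (𝓡 n) q →L[ℝ] ℝ :=
  fderiv ℝ (fun w : TangentSpace (𝓡 n) q => L ⟨q, w⟩) v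

/-- The energy `E(q,v) = d_v L(q,v)[v] - L(q,v)`. -/
def energy (L : TangentBundle (𝓡 n) M → ℝ) (p : TangentBundle (𝓡 n) M) : ℝ :=
  fiberDeriv L p.1 p.2 p.2 - L p

/-- The velocity of `γ : [0,T] → M` at time `t` (one-sided at the endpoints). -/
def velocity (T : ℝ) (γ : ℝ → M) (t : ℝ) : TangentSpace (𝓡 n) (γ t) :=
  mfderivWithin 𝓘(ℝ, ℝ) (𝓡 n) γ (Icc 0 T) t (1 : ℝ)

/-- The Lagrangian read in a chart, as a function of position `x` and velocity `y`. -/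
def chartLagrangian (L : TangentBundle (𝓡 n) M → ℝ)
    (φ : OpenPartialHomeomorph M (EuclideanSpace ℝ (Fin n)))
    (x y : EuclideanSpace ℝ (Fin n)) : ℝ :=
  L ⟨φ.symm x, mfderiv 𝓘(ℝ, EuclideanSpace ℝ (Fin n)) (𝓡 n) φ.symm x y⟩

/-- `γ : [0,T] → M` is a (smooth) Euler–Lagrange orbit: in every smooth chart it satisfies
`d/dt ∂L/∂v (x(t), x'(t)) = ∂L/∂q (x(t), x'(t))`. Only the values of `γ` on `[0,T]` matter. -/
def IsEulerLagrangeOrbit (L : TangentBundle (𝓡 n) M → ℝ) (T : ℝ) (γ : ℝ → M) : Prop :=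
  0 < T ∧ ContMDiffOn 𝓘(ℝ, ℝ) (𝓡 n) ∞ γ (Icc 0 T) ∧
  ∀ φ ∈ IsManifold.maximalAtlas (𝓡 n) ∞ M, ∀ t ∈ Icc 0 T, γ t ∈ φ.source →
    HasDerivWithinAt
      (fun s => fderiv ℝ (fun y => chartLagrangian L φ (φ (γ s)) y)
        (derivWithin (fun r => φ (γ r)) (Icc 0 T) s))
      (fderiv ℝ (fun x => chartLagrangian L φ x (derivWithin (fun r => φ (γ r)) (Icc 0 T) t))
        (φ (γ t)))
      (Icc 0 T) t

/-- `γ : [0,T] → M` lies on the energy level `E⁻¹(k)`. -/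
def HasEnergy (L : TangentBundle (𝓡 n) M → ℝ) (T : ℝ) (γ : ℝ → M) (k : ℝ) : Prop :=
  ∀ t ∈ Icc 0 T, energy L ⟨γ t, velocity T γ t⟩ = k

/-- The conormal boundary conditions: `γ : [0,T] → M` goes from `Q₀` to `Q₁`, and `d_v L` vanishes on
`T Q₀` at the initial point and on `T Q₁` at the final point. -/
def SatisfiesConormal (L : TangentBundle (𝓡 n) M → ℝ) (Q₀ Q₁ : Set M) (T : ℝ) (γ : ℝ → M) :
    Prop :=
  γ 0 ∈ Q₀ ∧ γ T ∈ Q₁ ∧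
  (∀ ζ ∈ tangentVectors Q₀ (γ 0), fiberDeriv L (γ 0) (velocity T γ 0) ζ = 0) ∧
  (∀ ζ ∈ tangentVectors Q₁ (γ T), fiberDeriv L (γ T) (velocity T γ T) ζ = 0)

/-! ### The Mañé critical value of the universal cover -/

/-- `γ : [0,T] → M` is of Sobolev class `H¹`: it is continuous and, in every smooth chart, absolutely
continuous with square-integrable derivative. -/
def IsH1Curve (n : ℕ) {M : Type*} [TopologicalSpace M]
    [ChartedSpace (EuclideanSpace ℝ (Fin n)) M] (T : ℝ) (γ : ℝ → M) : Prop :=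
  ContinuousOn γ (Icc 0 T) ∧
  ∀ φ ∈ IsManifold.maximalAtlas (𝓡 n) ∞ M, ∀ a b : ℝ, 0 ≤ a → a ≤ b → b ≤ T →
    (∀ t ∈ Icc a b, γ t ∈ φ.source) →
    AbsolutelyContinuousOnInterval (fun t => φ (γ t)) a b ∧
    MemLp (deriv (fun t => φ (γ t))) 2 (volume.restrict (Ioo a b))

/-- `γ : [0,T] → M` is a closed loop which is contractible in `M`. -/
def IsContractibleLoop {M : Type*} [TopologicalSpace M] (T : ℝ) (γ : ℝ → M) : Prop :=
  ∃ p : Path (γ 0) (γ 0), (∀ s : unitInterval, p s = γ (s * T)) ∧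
    p.Homotopic (Path.refl (γ 0))

/-- The free-time action `𝔸_k(γ) = ∫₀ᵀ (L(γ,γ') + k) dt` of `γ : [0,T] → M`. -/
def freeTimeAction (L : TangentBundle (𝓡 n) M → ℝ) (k T : ℝ) (γ : ℝ → M) : ℝ :=
  ∫ t in (0 : ℝ)..T, (L ⟨γ t, velocity T γ t⟩ + k)

/-- The real number `c` is the Mañé critical value `c_u(L)` of the universal cover: the infimum of
all `k` such that every contractible closed `H¹` loop has non-negative action `𝔸_k`. -/
def IsManeCriticalValueUniversalCover (L : TangentBundle (𝓡 n) M → ℝ) (c : ℝ) : Prop :=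
  IsGLB {k : ℝ | ∀ (T : ℝ) (γ : ℝ → M), 0 < T → IsH1Curve n T γ → IsContractibleLoop T γ →
    0 ≤ freeTimeAction L k T γ} c

end

end MagneticOrbits

end

noncomputable section

namespace MagneticOrbits

/-! A single Lagrangian serves every `ε`: its critical value is exactly `½`. Take `Q₀ = Q₁ = C`, a
small circle in a chart, and build `g` and `θ` with `θ(v)² ≤ g(v,v)` everywhere and with `g(τ,τ) =
1`, `θ(τ) = -1` for the velocity `τ` of `C`.

Then `L + ½ ≥ ½ (θ(v) + 1)² ≥ 0`, so `c_u ≤ ½`; and `L = -½` along the contractible loop `C`, so its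
action is `(k - ½) T` and `c_u ≥ ½` (`isManeCriticalValueUniversalCover_half`). The conormal
condition at the initial point reads `g(v,τ) = -θ(τ) = 1`, so Cauchy–Schwarz forces `g(v,v) ≥ 1`,
that is, energy at least `½` (`fiberDeriv_ne_zero_of_energy_lt`). The obstruction thus lies in the
initial velocity alone.

For the construction, let `z = (x, y)` be a cut-off chart in which `C` is the unit circle, and `e`
an immersion into Euclidean space. Put `θ = y dx - x dy` and `g = |z|² |dz|² + u |de|²`, with `u ≥
0` vanishing exactly on `C`. The first term of `g` dominates `θ²` (`sq_circleForm_le`); the second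
makes `g` definite off `C`, while on `C` the chart itself is an immersion (`circleBilin_pos`). -/

lemma _root_.ContinuousLinearMap.exists_pos_mul_sq_norm_le {E : Type*} [NormedAddCommGroup E]
    [NormedSpace ℝ E] [FiniteDimensional ℝ E] (b : E →L[ℝ] E →L[ℝ] ℝ)
    (hb : ∀ v, v ≠ 0 → 0 < b v v) : ∃ m : ℝ, 0 < m ∧ ∀ v, m * ‖v‖ ^ 2 ≤ b v v := by
  have hcont : Continuous fun v => b v v := by fun_prop
  have : ∃ m : ℝ, 0 < m ∧ ∀ v ∈ Metric.sphere (0 : E) 1, m ≤ b v v := by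
    rcases (Metric.sphere (0 : E) 1).eq_empty_or_nonempty with h | h
    · exact ⟨1, one_pos, by simp [h]⟩
    · obtain ⟨v₀, hv₀, hmin⟩ := (isCompact_sphere (0 : E) 1).exists_isMinOn h hcont.continuousOn
      exact ⟨b v₀ v₀, hb v₀ (Metric.ne_of_mem_sphere hv₀ one_ne_zero), fun v hv => hmin hv⟩
  obtain ⟨m, hm, h⟩ := this
  refine ⟨m, hm, fun v => ?_⟩
  rcases eq_or_ne v 0 with rfl | hv
  · simp
  have hv' : ‖v‖ ≠ 0 := norm_ne_zero_iff.2 hv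
  have := h (‖v‖⁻¹ • v) (by simp [norm_smul, hv'])
  simp only [map_smul, _root_.smul_apply, smul_eq_mul] at this
  calc m * ‖v‖ ^ 2 ≤ (‖v‖⁻¹ * (‖v‖⁻¹ * b v v)) * ‖v‖ ^ 2 := by gcongr
    _ = b v v := by field_simp

/-- Boundedness of unit balls is one of the fields of `Bundle.ContMDiffRiemannianMetric`. -/
lemma _root_.ContinuousLinearMap.isVonNBounded_setOf_lt_one {E : Type*} [NormedAddCommGroup E]
    [NormedSpace ℝ E] [FiniteDimensional ℝ E] (b : E →L[ℝ] E →L[ℝ] ℝ)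
    (hb : ∀ v, v ≠ 0 → 0 < b v v) : Bornology.IsVonNBounded ℝ {v : E | b v v < 1} := by
  obtain ⟨m, hm, h⟩ := b.exists_pos_mul_sq_norm_le hb
  rw [NormedSpace.isVonNBounded_iff, isBounded_iff_forall_norm_le]
  refine ⟨1 + m⁻¹, fun v hv => ?_⟩
  have h1 : ‖v‖ ^ 2 ≤ m⁻¹ := by
    rw [← one_div, le_div_iff₀' hm]
    exact (h v).trans (le_of_lt hv)
  nlinarith [norm_nonneg v, sq_nonneg (‖v‖ - 1)]

/-! ### Metrics, 1-forms and Lagrangians pulled back from a vector space -/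

section Pullback

variable {n : ℕ} {M : Type*} [TopologicalSpace M] [ChartedSpace (EuclideanSpace ℝ (Fin n)) M]
  {F : Type*} [NormedAddCommGroup F] [NormedSpace ℝ F]

/-- The differential of a map into a vector space, as a vector-valued 1-form. -/
def differential (Φ : M → F) (q : M) : TangentSpace (𝓡 n) q →L[ℝ] F :=
  mfderiv (𝓡 n) 𝓘(ℝ, F) Φ q

/-- The 1-form `A(q) ∘ dΦ(q)` on `M`. -/
def pullbackForm (Φ : M → F) (A : M → F →L[ℝ] ℝ) (q : M) : TangentSpace (𝓡 n) q →L[ℝ] ℝ :=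
  (A q).comp (differential Φ q)

/-- The bilinear form `B(q)(dΦ(q) ·, dΦ(q) ·)` on `M`. -/
def pullbackBilin (Φ : M → F) (B : M → F →L[ℝ] F →L[ℝ] ℝ) (q : M) :
    TangentSpace (𝓡 n) q →L[ℝ] TangentSpace (𝓡 n) q →L[ℝ] ℝ :=
  (ContinuousLinearMap.precomp ℝ (differential Φ q)).comp ((B q).comp (differential Φ q))

/-- The magnetic Lagrangian `½ B(q)(dΦ(q) v, dΦ(q) v) + A(q)(dΦ(q) v)`. -/
def pullbackLagrangian (Φ : M → F) (B : M → F →L[ℝ] F →L[ℝ] ℝ) (A : M → F →L[ℝ] ℝ)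
    (p : TangentBundle (𝓡 n) M) : ℝ :=
  1 / 2 * B p.1 (differential Φ p.1 p.2) (differential Φ p.1 p.2) + A p.1 (differential Φ p.1 p.2)

lemma fiberDeriv_pullbackLagrangian {Φ : M → F} {B : M → F →L[ℝ] F →L[ℝ] ℝ}
    (hsymm : ∀ q v w, B q v w = B q w v) {A : M → F →L[ℝ] ℝ} (q : M)
    (v ζ : TangentSpace (𝓡 n) q) :
    fiberDeriv (pullbackLagrangian Φ B A) q v ζ =
      B q (differential Φ q v) (differential Φ q ζ) + A q (differential Φ q ζ) := by
  let D : EuclideanSpace ℝ (Fin n) →L[ℝ] F := differential Φ q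
  have h : HasFDerivAt (𝕜 := ℝ) (fun w : EuclideanSpace ℝ (Fin n) =>
      1 / 2 * B q (D w) (D w) + A q (D w))
      ((1 / 2 : ℝ) • ((B q).flip (D v) ∘L D + B q (D v) ∘L D) + A q ∘L D) v := by
    have hD := D.hasFDerivAt (x := v)
    have hBD : HasFDerivAt (fun w => B q (D w)) (B q ∘L D) v := ((B q) ∘L D).hasFDerivAt
    have h2 := (hBD.clm_apply hD).const_mul (1 / 2 : ℝ)
    refine (h2.add (A q ∘L D).hasFDerivAt).congr_fderiv ?_
    ext w
    simp
    ring
  have : fiberDeriv (pullbackLagrangian Φ B A) q v = _ := h.fderiv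
  rw [this]
  change 1 / 2 * (B q (D ζ) (D v) + B q (D v) (D ζ)) + A q (D ζ) = B q (D v) (D ζ) + A q (D ζ)
  rw [hsymm q (D ζ) (D v)]
  ring

lemma energy_pullbackLagrangian {Φ : M → F} {B : M → F →L[ℝ] F →L[ℝ] ℝ}
    (hsymm : ∀ q v w, B q v w = B q w v) {A : M → F →L[ℝ] ℝ} (q : M)
    (v : TangentSpace (𝓡 n) q) :
    energy (pullbackLagrangian Φ B A) ⟨q, v⟩ =
      1 / 2 * B q (differential Φ q v) (differential Φ q v) := by
  rw [energy, fiberDeriv_pullbackLagrangian hsymm, pullbackLagrangian]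
  ring

/-- If `τ` is a `g`-unit vector with `θ(τ) = -1` then no vector `v` of energy below `½` satisfies
`d_v L(q,v)[τ] = 0`. -/
lemma fiberDeriv_ne_zero_of_energy_lt {Φ : M → F} {B : M → F →L[ℝ] F →L[ℝ] ℝ}
    (hsymm : ∀ q v w, B q v w = B q w v)
    (hnonneg : ∀ q v, 0 ≤ B q v v) {A : M → F →L[ℝ] ℝ} {q : M} {v τ : TangentSpace (𝓡 n) q}
    (hB : B q (differential Φ q τ) (differential Φ q τ) = 1) (hA : A q (differential Φ q τ) = -1)
    (hv : energy (pullbackLagrangian Φ B A) ⟨q, v⟩ < 1 / 2) :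
    fiberDeriv (pullbackLagrangian Φ B A) q v τ ≠ 0 := by
  rw [energy_pullbackLagrangian hsymm] at hv
  rw [fiberDeriv_pullbackLagrangian hsymm, hA]
  intro h
  -- Here `h` says `g(v,τ) = 1`, so `0 ≤ g(v - τ, v - τ) = g(v,v) - 1`.
  have := hnonneg q (differential Φ q v - differential Φ q τ)
  simp only [map_sub, _root_.sub_apply, hB, hsymm q (differential Φ q τ)] at this
  linarith

variable [IsManifold (𝓡 n) ∞ M]

/-- The differential of a smooth map into a vector space is smooth in the trivialization at `q₀`. -/
lemma contMDiffAt_differential_comp_symmL {Φ : M → F} (hΦ : ContMDiff (𝓡 n) 𝓘(ℝ, F) ∞ Φ)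
    (q₀ : M) :
    ContMDiffAt (𝓡 n) 𝓘(ℝ, EuclideanSpace ℝ (Fin n) →L[ℝ] F) ∞
      (fun q => (differential Φ q).comp
        ((trivializationAt (EuclideanSpace ℝ (Fin n)) (TangentSpace (𝓡 n)) q₀).symmL ℝ q)) q₀ := by
  have h := (hΦ q₀).mfderiv_const (m := ∞) le_rfl
  -- The target is a vector space, so its tangent trivialization is the identity and only the source
  -- is put in coordinates.
  refine h.congr_of_eventuallyEq (Filter.Eventually.of_forall fun q => ?_)
  ext1 v
  simp [inTangentCoordinates, ContinuousLinearMap.inCoordinates, differential]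
  rfl

lemma contMDiff_pullbackForm {Φ : M → F} (hΦ : ContMDiff (𝓡 n) 𝓘(ℝ, F) ∞ Φ) {A : M → F →L[ℝ] ℝ}
    (hA : ContMDiff (𝓡 n) 𝓘(ℝ, F →L[ℝ] ℝ) ∞ A) :
    ContMDiff (𝓡 n) ((𝓡 n).prod 𝓘(ℝ, EuclideanSpace ℝ (Fin n) →L[ℝ] ℝ)) ∞
      (fun q => Bundle.TotalSpace.mk' (EuclideanSpace ℝ (Fin n) →L[ℝ] ℝ)
        (E := fun q : M => TangentSpace (𝓡 n) q →L[ℝ] ℝ) q (pullbackForm Φ A q)) := by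
  intro q₀
  rw [contMDiffAt_hom_bundle]
  refine ⟨contMDiffAt_id, ?_⟩
  refine ((hA q₀).clm_comp (contMDiffAt_differential_comp_symmL hΦ q₀)).congr_of_eventuallyEq
    (Filter.Eventually.of_forall fun q => ?_)
  ext1 v
  simp [pullbackForm, ContinuousLinearMap.inCoordinates]

set_option synthInstance.maxHeartbeats 200000 in
set_option maxHeartbeats 1000000 in
lemma contMDiff_pullbackBilin {Φ : M → F} (hΦ : ContMDiff (𝓡 n) 𝓘(ℝ, F) ∞ Φ)
    {B : M → F →L[ℝ] F →L[ℝ] ℝ} (hB : ContMDiff (𝓡 n) 𝓘(ℝ, F →L[ℝ] F →L[ℝ] ℝ) ∞ B) :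
    ContMDiff (𝓡 n) ((𝓡 n).prod
      𝓘(ℝ, EuclideanSpace ℝ (Fin n) →L[ℝ] EuclideanSpace ℝ (Fin n) →L[ℝ] ℝ)) ∞
      (fun q => Bundle.TotalSpace.mk'
        (EuclideanSpace ℝ (Fin n) →L[ℝ] EuclideanSpace ℝ (Fin n) →L[ℝ] ℝ)
        (E := fun q : M => TangentSpace (𝓡 n) q →L[ℝ] TangentSpace (𝓡 n) q →L[ℝ] ℝ) q
        (pullbackBilin Φ B q)) := by
  intro q₀
  rw [contMDiffAt_hom_bundle]
  refine ⟨contMDiffAt_id, ?_⟩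
  have hD := contMDiffAt_differential_comp_symmL hΦ q₀
  -- In coordinates the form is `Dᵀ B D`. Precomposition with `D` depends linearly on `D`, hence
  -- smoothly on the point.
  have hT : ContMDiffAt (𝓡 n) 𝓘(ℝ, (F →L[ℝ] ℝ) →L[ℝ] EuclideanSpace ℝ (Fin n) →L[ℝ] ℝ) ∞
      (fun q => (ContinuousLinearMap.compL ℝ (EuclideanSpace ℝ (Fin n)) F ℝ).flip
        ((differential Φ q).comp
        ((trivializationAt (EuclideanSpace ℝ (Fin n)) (TangentSpace (𝓡 n)) q₀).symmL ℝ q))) q₀ :=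
    contMDiffAt_const.clm_apply hD
  refine (hT.clm_comp ((hB q₀).clm_comp hD)).congr_of_eventuallyEq ?_
  have hq : ∀ᶠ q in 𝓝 q₀, q ∈ (trivializationAt (EuclideanSpace ℝ (Fin n))
      (TangentSpace (𝓡 n) : M → Type _) q₀).baseSet :=
    (trivializationAt (EuclideanSpace ℝ (Fin n))
      (TangentSpace (𝓡 n) : M → Type _) q₀).open_baseSet.mem_nhds
      (FiberBundle.mem_baseSet_trivializationAt' q₀)
  filter_upwards [hq] with q hq
  ext1 v
  ext1 w
  refine (inCoordinates_apply_eq₂ hq hq (mem_univ _)).trans ?_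
  rw [← Bundle.Trivialization.symmL_apply (R := ℝ) _ hq, ← Bundle.Trivialization.symmL_apply (R := ℝ) _ hq]
  simp [pullbackBilin]

/-- The Riemannian metric `B(q)(dΦ(q) ·, dΦ(q) ·)` on `M`. -/
def pullbackMetric (Φ : M → F) (hΦ : ContMDiff (𝓡 n) 𝓘(ℝ, F) ∞ Φ)
    (B : M → F →L[ℝ] F →L[ℝ] ℝ) (hB : ContMDiff (𝓡 n) 𝓘(ℝ, F →L[ℝ] F →L[ℝ] ℝ) ∞ B)
    (hsymm : ∀ q v w, B q v w = B q w v)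
    (hpos : ∀ q (v : TangentSpace (𝓡 n) q), v ≠ 0 →
      0 < B q (differential Φ q v) (differential Φ q v)) :
    Bundle.ContMDiffRiemannianMetric (𝓡 n) ∞ (EuclideanSpace ℝ (Fin n))
      (fun q : M => TangentSpace (𝓡 n) q) where
  inner := pullbackBilin Φ B
  symm q _ _ := hsymm q _ _
  pos := hpos
  isVonNBounded q := ContinuousLinearMap.isVonNBounded_setOf_lt_one
    (E := EuclideanSpace ℝ (Fin n)) (pullbackBilin Φ B q) (hpos q)
  contMDiff := contMDiff_pullbackBilin hΦ hB

/-- The smooth 1-form `A(q) ∘ dΦ(q)` on `M`. -/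
def pullbackSection (Φ : M → F) (hΦ : ContMDiff (𝓡 n) 𝓘(ℝ, F) ∞ Φ)
    (A : M → F →L[ℝ] ℝ) (hA : ContMDiff (𝓡 n) 𝓘(ℝ, F →L[ℝ] ℝ) ∞ A) :
    Cₛ^∞⟮𝓡 n; EuclideanSpace ℝ (Fin n) →L[ℝ] ℝ, fun q : M => TangentSpace (𝓡 n) q →L[ℝ] ℝ⟯ where
  toFun := pullbackForm Φ A
  contMDiff_toFun := contMDiff_pullbackForm hΦ hA

lemma isMagneticLagrangian_pullbackLagrangian {Φ : M → F} (hΦ : ContMDiff (𝓡 n) 𝓘(ℝ, F) ∞ Φ)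
    {B : M → F →L[ℝ] F →L[ℝ] ℝ} (hB : ContMDiff (𝓡 n) 𝓘(ℝ, F →L[ℝ] F →L[ℝ] ℝ) ∞ B)
    (hsymm : ∀ q v w, B q v w = B q w v)
    (hpos : ∀ q (v : TangentSpace (𝓡 n) q), v ≠ 0 →
      0 < B q (differential Φ q v) (differential Φ q v))
    {A : M → F →L[ℝ] ℝ} (hA : ContMDiff (𝓡 n) 𝓘(ℝ, F →L[ℝ] ℝ) ∞ A) :
    IsMagneticLagrangian (pullbackLagrangian Φ B A : TangentBundle (𝓡 n) M → ℝ) :=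
  ⟨pullbackMetric Φ hΦ B hB hsymm hpos, pullbackSection Φ hΦ A hA, fun _ _ => rfl⟩

end Pullback

/-! ### The unit circle in the plane -/

section UnitCircle

/-- The unit-speed parametrization of the unit circle of the Euclidean plane. -/
def unitCircle (t : ℝ) : EuclideanSpace ℝ (Fin 2) :=
  Real.cos t • EuclideanSpace.single 0 1 + Real.sin t • EuclideanSpace.single 1 1

/-- The velocity of `unitCircle`. -/
def unitCircleVelocity (t : ℝ) : EuclideanSpace ℝ (Fin 2) :=
  (-Real.sin t) • EuclideanSpace.single 0 1 + Real.cos t • EuclideanSpace.single 1 1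

@[simp] lemma unitCircle_zero (t : ℝ) : unitCircle t 0 = Real.cos t := by simp [unitCircle]

@[simp] lemma unitCircle_one (t : ℝ) : unitCircle t 1 = Real.sin t := by simp [unitCircle]

@[simp] lemma unitCircleVelocity_zero (t : ℝ) : unitCircleVelocity t 0 = -Real.sin t := by
  simp [unitCircleVelocity]

@[simp] lemma unitCircleVelocity_one (t : ℝ) : unitCircleVelocity t 1 = Real.cos t := by
  simp [unitCircleVelocity]

lemma norm_unitCircle (t : ℝ) : ‖unitCircle t‖ = 1 := by
  simp [EuclideanSpace.norm_eq, Fin.sum_univ_two]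

lemma norm_unitCircleVelocity (t : ℝ) : ‖unitCircleVelocity t‖ = 1 := by
  simp [EuclideanSpace.norm_eq, Fin.sum_univ_two]

lemma hasDerivAt_unitCircle (t : ℝ) : HasDerivAt unitCircle (unitCircleVelocity t) t :=
  ((Real.hasDerivAt_cos t).smul_const _).add ((Real.hasDerivAt_sin t).smul_const _)

lemma contDiff_unitCircle {n : WithTop ℕ∞} : ContDiff ℝ n unitCircle :=
  (Real.contDiff_cos.smul contDiff_const).add (Real.contDiff_sin.smul contDiff_const)

lemma periodic_unitCircle : Function.Periodic unitCircle (2 * Real.pi) := fun t => by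
  simp [unitCircle]

lemma exists_unitCircle_eq {z : EuclideanSpace ℝ (Fin 2)} (hz : ‖z‖ = 1) :
    ∃ t, unitCircle t = z := by
  have h : z 0 ^ 2 + z 1 ^ 2 = 1 := by
    simpa [EuclideanSpace.norm_eq, Fin.sum_univ_two] using hz
  have hw : ‖(⟨z 0, z 1⟩ : ℂ)‖ = 1 := by
    rw [Complex.norm_def, Complex.normSq_mk, ← sq, ← sq, h, Real.sqrt_one]
  refine ⟨Complex.arg ⟨z 0, z 1⟩, ?_⟩
  ext i
  fin_cases i
  · simp [Complex.cos_arg (norm_ne_zero_iff.1 (hw ▸ one_ne_zero)), hw]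
  · simp [Complex.sin_arg, hw]

end UnitCircle

/-! ### A small circle in a chart and the cut-off chart -/

section SmallCircle

variable {S : Type*} [TopologicalSpace S] [ChartedSpace (EuclideanSpace ℝ (Fin 2)) S]
  {q₀ : S} (f : SmoothBumpFunction (𝓡 2) q₀)

/-- The point of the plane with angle `t` on the circle of radius `f.rIn / 2`. -/
def chartCircle (t : ℝ) : EuclideanSpace ℝ (Fin 2) :=
  extChartAt (𝓡 2) q₀ q₀ + (f.rIn / 2) • unitCircle t

/-- The circle of radius `f.rIn / 2` in the chart at `q₀`. -/
def smallCircle (t : ℝ) : S := (extChartAt (𝓡 2) q₀).symm (chartCircle f t)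

/-- The chart at `q₀`, normalized so that `smallCircle f` becomes the unit circle, and cut off. -/
def cutoffChart (q : S) : EuclideanSpace ℝ (Fin 2) :=
  f q • ((2 / f.rIn) • (extChartAt (𝓡 2) q₀ q - extChartAt (𝓡 2) q₀ q₀))

lemma dist_chartCircle (t : ℝ) : dist (chartCircle f t) (extChartAt (𝓡 2) q₀ q₀) = f.rIn / 2 := by
  have := f.rIn_pos
  rw [dist_eq_norm, chartCircle, add_sub_cancel_left, norm_smul, norm_unitCircle, mul_one,
    Real.norm_of_nonneg (by positivity)]

lemma closedBall_rIn_subset_target :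
    Metric.closedBall (extChartAt (𝓡 2) q₀ q₀) f.rIn ⊆ (extChartAt (𝓡 2) q₀).target := by
  refine fun x hx => f.ball_subset ⟨?_, by simp⟩
  exact (Metric.mem_closedBall.1 hx).trans_lt f.rIn_lt_rOut

lemma chartCircle_mem_closedBall (t : ℝ) :
    chartCircle f t ∈ Metric.closedBall (extChartAt (𝓡 2) q₀ q₀) f.rIn := by
  have := f.rIn_pos
  rw [Metric.mem_closedBall, dist_chartCircle]
  linarith

lemma chartCircle_mem_target (t : ℝ) : chartCircle f t ∈ (extChartAt (𝓡 2) q₀).target :=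
  closedBall_rIn_subset_target f (chartCircle_mem_closedBall f t)

lemma extChartAt_smallCircle (t : ℝ) : extChartAt (𝓡 2) q₀ (smallCircle f t) = chartCircle f t :=
  (extChartAt (𝓡 2) q₀).right_inv (chartCircle_mem_target f t)

lemma smallCircle_mem_source (t : ℝ) :
    smallCircle f t ∈ (chartAt (EuclideanSpace ℝ (Fin 2)) q₀).source := by
  rw [← extChartAt_source (𝓡 2)]
  exact (extChartAt (𝓡 2) q₀).map_target (chartCircle_mem_target f t)

lemma mem_range_smallCircle {q : S} : q ∈ range (smallCircle f) ↔
    q ∈ (chartAt (EuclideanSpace ℝ (Fin 2)) q₀).source ∧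
      dist (extChartAt (𝓡 2) q₀ q) (extChartAt (𝓡 2) q₀ q₀) = f.rIn / 2 := by
  constructor
  · rintro ⟨t, rfl⟩
    exact ⟨smallCircle_mem_source f t, by rw [extChartAt_smallCircle, dist_chartCircle]⟩
  · rintro ⟨hq, hd⟩
    have hr := f.rIn_pos
    obtain ⟨t, ht⟩ := exists_unitCircle_eq
      (z := (2 / f.rIn) • (extChartAt (𝓡 2) q₀ q - extChartAt (𝓡 2) q₀ q₀)) (by
        rw [norm_smul, ← dist_eq_norm, hd, Real.norm_of_nonneg (by positivity)]
        field_simp)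
    refine ⟨t, ?_⟩
    rw [smallCircle, chartCircle, ht, smul_smul, show f.rIn / 2 * (2 / f.rIn) = 1 by field_simp,
      one_smul, add_sub_cancel, (extChartAt (𝓡 2) q₀).left_inv (by rwa [extChartAt_source])]

lemma bump_smallCircle (t : ℝ) : f (smallCircle f t) = 1 :=
  f.one_of_dist_le (smallCircle_mem_source f t) (by
    rw [extChartAt_smallCircle]; exact chartCircle_mem_closedBall f t)

lemma cutoffChart_smallCircle (t : ℝ) : cutoffChart f (smallCircle f t) = unitCircle t := by
  have := f.rIn_pos
  rw [cutoffChart, bump_smallCircle, one_smul, extChartAt_smallCircle, chartCircle,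
    add_sub_cancel_left, smul_smul, show 2 / f.rIn * (f.rIn / 2) = 1 by field_simp, one_smul]

lemma periodic_smallCircle : Function.Periodic (smallCircle f) (2 * Real.pi) := fun t => by
  rw [smallCircle, chartCircle, periodic_unitCircle, smallCircle, chartCircle]

/-- Norm one alone does not locate the circle: the cut-off chart takes norm one again where `f`
decays. The condition `f q = 1` excludes those points and places `q` in the chart domain. -/
lemma mem_range_smallCircle_of_norm_cutoffChart {q : S} (h1 : f q = 1)
    (h2 : ‖cutoffChart f q‖ = 1) : q ∈ range (smallCircle f) := by
  have hr := f.rIn_pos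
  refine (mem_range_smallCircle f).2 ⟨f.support_subset_source (by simp [h1]), ?_⟩
  rw [cutoffChart, h1, one_smul, norm_smul, Real.norm_of_nonneg (by positivity)] at h2
  rw [dist_eq_norm]
  field_simp at h2
  linarith

/-- The chain rule along a curve. -/
lemma differential_mfderiv_of_hasDerivAt {F : Type*} [NormedAddCommGroup F] [NormedSpace ℝ F]
    {Φ : S → F} {γ : ℝ → S} {t : ℝ} {v : F} (hΦ : MDifferentiableAt (𝓡 2) 𝓘(ℝ, F) Φ (γ t))
    (hγ : MDifferentiableAt 𝓘(ℝ, ℝ) (𝓡 2) γ t) (h : HasDerivAt (fun s => Φ (γ s)) v t) :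
    differential Φ (γ t) (mfderiv 𝓘(ℝ, ℝ) (𝓡 2) γ t (1 : ℝ)) = v := by
  have key : ∀ D : ℝ →L[ℝ] F, HasFDerivAt (Φ ∘ γ) D t → D 1 = v :=
    fun _ hD => hD.hasDerivAt.unique h
  exact key _ (hΦ.hasMFDerivAt.comp t hγ.hasMFDerivAt).hasFDerivAt

variable [IsManifold (𝓡 2) ∞ S]

lemma contMDiff_smallCircle : ContMDiff 𝓘(ℝ, ℝ) (𝓡 2) ∞ (smallCircle f) := by
  have h : ContMDiff 𝓘(ℝ, ℝ) (𝓡 2) ∞ (chartCircle f) :=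
    (contDiff_const.add (contDiff_unitCircle.const_smul _)).contMDiff
  exact (contMDiffOn_extChartAt_symm q₀).comp_contMDiff h (chartCircle_mem_target f)

lemma contMDiff_cutoffChart [T2Space S] :
    ContMDiff (𝓡 2) 𝓘(ℝ, EuclideanSpace ℝ (Fin 2)) ∞ (cutoffChart f) := by
  refine f.contMDiff_smul ?_
  have h : ContMDiffOn (𝓡 2) 𝓘(ℝ, EuclideanSpace ℝ (Fin 2)) ∞ (extChartAt (𝓡 2) q₀)
      (chartAt (EuclideanSpace ℝ (Fin 2)) q₀).source := contMDiffOn_extChartAt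
  have h2 : ContDiff ℝ ∞ fun x : EuclideanSpace ℝ (Fin 2) =>
      (2 / f.rIn) • (x - extChartAt (𝓡 2) q₀ q₀) :=
    (contDiff_id.sub contDiff_const).const_smul _
  exact h2.contMDiff.comp_contMDiffOn h

/-- The cut-off chart is an immersion along `smallCircle f`. -/
lemma injective_differential_cutoffChart (t : ℝ) :
    Function.Injective (differential (n := 2) (cutoffChart f) (smallCircle f t)) := by
  have hr := f.rIn_pos
  have hs := smallCircle_mem_source f t
  -- The radius `f.rIn / 2` is strictly below `f.rIn`, so `f = 1` near the circle and the cut-off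
  -- chart is locally an affine rescaling of the chart.
  have hev : cutoffChart f =ᶠ[𝓝 (smallCircle f t)]
      (fun x => (2 / f.rIn) • (x - extChartAt (𝓡 2) q₀ q₀)) ∘ extChartAt (𝓡 2) q₀ := by
    filter_upwards [f.eventuallyEq_one_of_dist_lt hs (by
      rw [extChartAt_smallCircle, dist_chartCircle]; linarith)] with q hq
    simp [cutoffChart, hq]
  have hd : HasFDerivAt (fun x => (2 / f.rIn) • (x - extChartAt (𝓡 2) q₀ q₀))
      ((2 / f.rIn) • ContinuousLinearMap.id ℝ (EuclideanSpace ℝ (Fin 2)))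
      (extChartAt (𝓡 2) q₀ (smallCircle f t)) :=
    ((hasFDerivAt_id _).sub_const _).fun_const_smul _
  have he := (mdifferentiableAt_extChartAt (I := 𝓡 2) hs).hasMFDerivAt
  have := ((hd.hasMFDerivAt.comp _ he).congr_of_eventuallyEq hev).mfderiv
  have hinj := (isInvertible_mfderiv_extChartAt (I := 𝓡 2) (x := q₀) (y := smallCircle f t)
    (by rwa [extChartAt_source])).injective
  rw [differential, this]
  intro v w hvw
  apply hinj
  have hne : (2 / f.rIn) ≠ 0 := by positivity
  exact smul_right_injective (EuclideanSpace ℝ (Fin 2)) hne hvw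

end SmallCircle

/-! ### Inversions as straightening charts -/

section Submanifold

/-- The inversion of a Euclidean space in the unit sphere around `c`, translated by `-w`. -/
def inversionChart {E : Type*} [NormedAddCommGroup E] [InnerProductSpace ℝ E] (c w : E) :
    OpenPartialHomeomorph E E where
  toFun x := EuclideanGeometry.inversion c 1 x - w
  invFun x := EuclideanGeometry.inversion c 1 (x + w)
  source := {c}ᶜ
  target := {c - w}ᶜ
  map_source' x hx := by
    simpa [sub_left_inj] using hx
  map_target' x hx := by
    simpa [eq_sub_iff_add_eq] using hx
  left_inv' x _ := by simp
  right_inv' x _ := by simp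
  open_source := isOpen_compl_singleton
  open_target := isOpen_compl_singleton
  continuousOn_toFun := (continuousOn_const.inversion continuousOn_const continuousOn_id
    fun _ hx => hx).sub continuousOn_const
  continuousOn_invFun := continuousOn_const.inversion continuousOn_const
    (continuousOn_id.add continuousOn_const) fun x hx => by
      simpa [eq_sub_iff_add_eq] using hx

lemma contDiffOn_inversionChart {E : Type*} [NormedAddCommGroup E] [InnerProductSpace ℝ E]
    (c w : E) : ContDiffOn ℝ ∞ (inversionChart c w) (inversionChart c w).source :=
  (contDiffOn_const.inversion contDiffOn_const contDiffOn_id fun _ hx => hx).sub contDiffOn_const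

lemma contDiffOn_inversionChart_symm {E : Type*} [NormedAddCommGroup E] [InnerProductSpace ℝ E]
    (c w : E) : ContDiffOn ℝ ∞ (inversionChart c w).symm (inversionChart c w).target :=
  contDiffOn_const.inversion contDiffOn_const (contDiffOn_id.add contDiffOn_const) fun x hx => by
    simpa [inversionChart, eq_sub_iff_add_eq] using hx

/-- An inversion at a point `c` of a circle maps the circle to a line. -/
lemma inversionChart_mem_iff {E : Type*} [NormedAddCommGroup E] [InnerProductSpace ℝ E]
    {c y p x : E} (hy : y ≠ c) (hp : p ≠ c) (hpy : dist p y = dist y c) (hx : x ≠ c) :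
    inversionChart c (EuclideanGeometry.inversion c 1 p) x ∈
      (ℝ ∙ (EuclideanGeometry.inversion c 1 y - c))ᗮ ↔ dist x y = dist y c := by
  -- The inverted sphere is the perpendicular bisector of `c` and the inverted centre; subtracting
  -- its point `inversion c 1 p` turns it into a linear subspace.
  have hp' := (EuclideanGeometry.inversion_mem_perpBisector_inversion_iff one_ne_zero hp hy).2 hpy
  rw [← EuclideanGeometry.inversion_mem_perpBisector_inversion_iff one_ne_zero hx hy,
    ← AffineSubspace.vsub_right_mem_direction_iff_mem hp', AffineSubspace.direction_perpBisector]
  rfl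

variable {n : ℕ} {M : Type*} [TopologicalSpace M] [ChartedSpace (EuclideanSpace ℝ (Fin n)) M]
  [IsManifold (𝓡 n) ∞ M]

lemma trans_inversionChart_mem_maximalAtlas (q₀ : M) (c w : EuclideanSpace ℝ (Fin n)) :
    (chartAt (EuclideanSpace ℝ (Fin n)) q₀).trans (inversionChart c w) ∈
      IsManifold.maximalAtlas (𝓡 n) ∞ M := by
  have hφ := IsManifold.chart_mem_maximalAtlas (I := 𝓡 n) (n := ∞) q₀
  refine OpenPartialHomeomorph.mem_maximalAtlas_of_contMDiffOn _ ?_ ?_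
  · rw [OpenPartialHomeomorph.coe_trans, OpenPartialHomeomorph.trans_source]
    exact (contDiffOn_inversionChart c w).contMDiffOn.comp
      ((contMDiffOn_of_mem_maximalAtlas hφ).mono inter_subset_left) fun x hx => hx.2
  · rw [OpenPartialHomeomorph.coe_trans_symm, OpenPartialHomeomorph.trans_target]
    exact (contMDiffOn_symm_of_mem_maximalAtlas hφ).comp
      ((contDiffOn_inversionChart_symm c w).contMDiffOn.mono inter_subset_left) fun x hx => hx.2

end Submanifold

/-! ### The small circle as a contractible loop and a submanifold -/

section SmallCircle

variable {S : Type*} [TopologicalSpace S] [ChartedSpace (EuclideanSpace ℝ (Fin 2)) S]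
  {q₀ : S} (f : SmoothBumpFunction (𝓡 2) q₀)

/-- The loop bounds a disc: it lifts to a closed ball in the chart, which is convex, hence simply
connected, and the inverse chart carries the null-homotopy to the surface. -/
lemma isContractibleLoop_smallCircle : IsContractibleLoop (2 * Real.pi) (smallCircle f) := by
  let K := Metric.closedBall (extChartAt (𝓡 2) q₀ q₀) f.rIn
  let ψ : C(K, S) := ⟨fun x => (extChartAt (𝓡 2) q₀).symm x,
    ((continuousOn_extChartAt_symm q₀).mono (closedBall_rIn_subset_target f)).domRestrict⟩
  have hK : ContractibleSpace K := (convex_closedBall _ _).contractibleSpace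
    ⟨_, chartCircle_mem_closedBall f 0⟩
  let b : ℝ → K := fun t => ⟨chartCircle f t, chartCircle_mem_closedBall f t⟩
  have hb : Continuous b :=
    Continuous.subtype_mk (continuous_const.add
      ((contDiff_unitCircle (n := 0)).continuous.fun_const_smul (f.rIn / 2))) _
  let p : Path (b 0) (b 0) :=
    { toFun := fun s => b (s * (2 * Real.pi))
      continuous_toFun := hb.comp (by fun_prop)
      source' := by simp
      target' := by
        simpa [b, chartCircle] using
          congrArg ((f.rIn / 2) • ·) (periodic_unitCircle 0) }
  exact ⟨p.map ψ.continuous, fun s => rfl,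
    (SimplyConnectedSpace.paths_homotopic p (Path.refl _)).map ψ⟩

variable [IsManifold (𝓡 2) ∞ S]

/-- A chart must straighten the circle on its whole domain. Inversion at the point antipodal to the
given one does so: it sends the circle to a line, and the only point of the circle lost is the
centre of inversion. -/
lemma isSubmanifold_range_smallCircle : IsSubmanifold 2 1 (range (smallCircle f)) := by
  rintro _ ⟨t, rfl⟩
  have hr := f.rIn_pos
  set y := extChartAt (𝓡 2) q₀ q₀ with hy_def
  set p := chartCircle f t with hp_def
  set c := chartCircle f (t + Real.pi) with hc_def
  have hyc : dist y c = f.rIn / 2 := by rw [dist_comm, dist_chartCircle]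
  have hpy : dist p y = dist y c := by rw [hyc, dist_chartCircle]
  have hy : y ≠ c := dist_pos.1 (by rw [hyc]; positivity)
  have hpc : p - c = f.rIn • unitCircle t := by
    have : unitCircle (t + Real.pi) = -unitCircle t := by
      simp [unitCircle]; abel
    rw [hp_def, hc_def, chartCircle, chartCircle, this]
    module
  have hp : p ≠ c := by
    rw [← sub_ne_zero, hpc]
    refine smul_ne_zero hr.ne' (norm_ne_zero_iff.1 ?_)
    rw [norm_unitCircle]
    exact one_ne_zero
  refine ⟨_, trans_inversionChart_mem_maximalAtlas q₀ c (EuclideanGeometry.inversion c 1 p), ?_,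
    (ℝ ∙ (EuclideanGeometry.inversion c 1 y - c))ᗮ, ?_, ?_⟩
  · refine ⟨smallCircle_mem_source f t, ?_⟩
    change extChartAt (𝓡 2) q₀ (smallCircle f t) ≠ c
    rwa [extChartAt_smallCircle]
  · have : Fact (Module.finrank ℝ (EuclideanSpace ℝ (Fin 2)) = 1 + 1) := ⟨by simp⟩
    refine Submodule.finrank_orthogonal_span_singleton (sub_ne_zero.2 ?_)
    simpa [EuclideanGeometry.inversion_eq_center] using hy
  · rintro x ⟨hx, hxc⟩
    have hmem := inversionChart_mem_iff hy hp hpy (x := extChartAt (𝓡 2) q₀ x) hxc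
    rw [hyc] at hmem
    rw [mem_range_smallCircle]
    exact (and_iff_right hx).trans hmem.symm

lemma isClosedConnectedSubmanifold_range_smallCircle :
    IsClosedConnectedSubmanifold 2 (range (smallCircle f)) := by
  have hc := (contMDiff_smallCircle f).continuous
  refine ⟨?_, isConnected_range hc, 1, isSubmanifold_range_smallCircle f⟩
  rw [← (periodic_smallCircle f).image_Icc Real.two_pi_pos 0]
  exact isCompact_Icc.image hc

end SmallCircle

/-! ### Smooth curves are of class `H¹` -/

section H1

variable {n : ℕ} {M : Type*} [TopologicalSpace M] [ChartedSpace (EuclideanSpace ℝ (Fin n)) M]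

lemma isH1Curve_of_contMDiff {γ : ℝ → M} (hγ : ContMDiff 𝓘(ℝ, ℝ) (𝓡 n) ∞ γ) (T : ℝ) :
    IsH1Curve n T γ := by
  refine ⟨hγ.continuous.continuousOn, fun φ hφ a b _ hab _ hsource => ?_⟩
  have hU : IsOpen (γ ⁻¹' φ.source) := φ.open_source.preimage hγ.continuous
  have h : ContDiffOn ℝ ∞ (fun t => φ (γ t)) (γ ⁻¹' φ.source) :=
    ((contMDiffOn_of_mem_maximalAtlas hφ).comp hγ.contMDiffOn fun _ ht => ht).contDiffOn
  have hd : ContinuousOn (deriv fun t => φ (γ t)) (Icc a b) :=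
    (h.continuousOn_deriv_of_isOpen hU (by simp)).mono hsource
  obtain ⟨C, hC⟩ := isCompact_Icc.exists_bound_of_continuousOn hd
  refine ⟨ContDiffOn.absolutelyContinuousOnInterval ?_, MemLp.of_bound
    ((hd.mono Ioo_subset_Icc_self).aestronglyMeasurable measurableSet_Ioo) C ?_⟩
  · rw [uIcc_of_le hab]
    exact (h.mono hsource).of_le (by simp)
  · exact (ae_restrict_iff' measurableSet_Ioo).2
      (Filter.Eventually.of_forall fun t ht => hC t (Ioo_subset_Icc_self ht))

end H1

/-! ### Computing the critical value from a calibrated loop -/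

section ManeCriticalValue

variable {n : ℕ} {M : Type*} [TopologicalSpace M] [ChartedSpace (EuclideanSpace ℝ (Fin n)) M]

lemma velocity_eq_mfderiv {γ : ℝ → M} (hγ : ContMDiff 𝓘(ℝ, ℝ) (𝓡 n) ∞ γ) {T t : ℝ}
    (hT : 0 < T) (ht : t ∈ Icc 0 T) :
    velocity T γ t = mfderiv 𝓘(ℝ, ℝ) (𝓡 n) γ t (1 : ℝ) := by
  rw [velocity, mfderivWithin_eq_mfderiv ((uniqueDiffOn_Icc hT).uniqueMDiffOn t ht)
    (hγ.mdifferentiable (by simp) t)]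

/-- If `½ + L ≥ 0` and `L = -½` along the velocity of a smooth contractible loop, then the Mañé
critical value of the universal cover is `½`. -/
lemma isManeCriticalValueUniversalCover_half {L : TangentBundle (𝓡 n) M → ℝ}
    (hL : ∀ p, 0 ≤ L p + 1 / 2) {γ : ℝ → M} (hγ : ContMDiff 𝓘(ℝ, ℝ) (𝓡 n) ∞ γ) {T : ℝ}
    (hT : 0 < T) (hloop : IsContractibleLoop T γ)
    (hLγ : ∀ t, L ⟨γ t, mfderiv 𝓘(ℝ, ℝ) (𝓡 n) γ t (1 : ℝ)⟩ = -(1 / 2)) :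
    IsManeCriticalValueUniversalCover L (1 / 2) := by
  constructor
  · intro k hk
    have h := hk T γ hT (isH1Curve_of_contMDiff hγ T) hloop
    -- The action of the loop is `(k - ½) T`, so its non-negativity forces `k ≥ ½`.
    have hcongr : freeTimeAction L k T γ = ∫ _ in (0 : ℝ)..T, (k - 1 / 2) := by
      refine intervalIntegral.integral_congr fun t ht => ?_
      rw [uIcc_of_le hT.le] at ht
      simp only [velocity_eq_mfderiv hγ hT ht, hLγ]
      ring
    rw [hcongr, intervalIntegral.integral_const, sub_zero, smul_eq_mul] at h
    linarith [nonneg_of_mul_nonneg_right h hT]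
  · intro b hb
    exact hb fun T γ hT _ _ => intervalIntegral.integral_nonneg hT.le fun t _ => hL _

end ManeCriticalValue

/-! ### The Lagrangian adapted to the circle -/

section CircleLagrangian

/-- The pullback of the inner product under a linear map. -/
def innerComp {F G : Type*} [NormedAddCommGroup F] [NormedSpace ℝ F] [NormedAddCommGroup G]
    [InnerProductSpace ℝ G] (ℓ : F →L[ℝ] G) : F →L[ℝ] F →L[ℝ] ℝ :=
  (innerSL ℝ).bilinearComp ℓ ℓ

@[simp] lemma innerComp_apply {F G : Type*} [NormedAddCommGroup F] [NormedSpace ℝ F]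
    [NormedAddCommGroup G] [InnerProductSpace ℝ G] (ℓ : F →L[ℝ] G) (v w : F) :
    innerComp ℓ v w = inner ℝ (ℓ v) (ℓ w) := by
  simp [innerComp]

variable {S : Type*} [TopologicalSpace S] [ChartedSpace (EuclideanSpace ℝ (Fin 2)) S]
  {q₀ : S} (f : SmoothBumpFunction (𝓡 2) q₀)
  {N : ℕ} (e : S → EuclideanSpace ℝ (Fin N))

/-- The map to Euclidean space given by the cut-off chart and `e`. -/
def circleMap (q : S) : EuclideanSpace ℝ (Fin 2) × EuclideanSpace ℝ (Fin N) :=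
  (cutoffChart f q, e q)

/-- The coefficients of the 1-form `y dx - x dy`, where `(x, y)` is the cut-off chart. -/
def circleForm (N : ℕ) (q : S) :
    EuclideanSpace ℝ (Fin 2) × EuclideanSpace ℝ (Fin N) →L[ℝ] ℝ :=
  (cutoffChart f q 1) • ((EuclideanSpace.proj (𝕜 := ℝ) (0 : Fin 2)).comp (.fst ℝ _ _)) -
    (cutoffChart f q 0) • ((EuclideanSpace.proj (𝕜 := ℝ) (1 : Fin 2)).comp (.fst ℝ _ _))

/-- A function vanishing exactly on `smallCircle f`. -/
def circleDefect (q : S) : ℝ := (‖cutoffChart f q‖ ^ 2 - 1) ^ 2 + (1 - f q) ^ 2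

/-- The coefficients of the metric `(x² + y²)(dx² + dy²) + u g`, where `(x, y)` is the cut-off
chart, `u` vanishes exactly on `smallCircle f`, and `g` is the metric induced by `e`. -/
def circleBilin (N : ℕ) (q : S) : EuclideanSpace ℝ (Fin 2) × EuclideanSpace ℝ (Fin N) →L[ℝ]
    EuclideanSpace ℝ (Fin 2) × EuclideanSpace ℝ (Fin N) →L[ℝ] ℝ :=
  ‖cutoffChart f q‖ ^ 2 • innerComp (.fst ℝ _ _) + circleDefect f q • innerComp (.snd ℝ _ _)

lemma circleForm_apply (q : S) (ζ : EuclideanSpace ℝ (Fin 2) × EuclideanSpace ℝ (Fin N)) :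
    circleForm f N q ζ = cutoffChart f q 1 * ζ.1 0 - cutoffChart f q 0 * ζ.1 1 := by
  simp [circleForm]

lemma circleBilin_apply (q : S) (ζ η : EuclideanSpace ℝ (Fin 2) × EuclideanSpace ℝ (Fin N)) :
    circleBilin f N q ζ η =
      ‖cutoffChart f q‖ ^ 2 * inner ℝ ζ.1 η.1 + circleDefect f q * inner ℝ ζ.2 η.2 := by
  simp [circleBilin]

lemma circleBilin_symm (q : S) (ζ η : EuclideanSpace ℝ (Fin 2) × EuclideanSpace ℝ (Fin N)) :
    circleBilin f N q ζ η = circleBilin f N q η ζ := by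
  simp only [circleBilin_apply, real_inner_comm]

lemma circleDefect_nonneg (q : S) : 0 ≤ circleDefect f q := by
  unfold circleDefect
  positivity

lemma mem_range_smallCircle_of_circleDefect_eq_zero {q : S} (h : circleDefect f q = 0) :
    q ∈ range (smallCircle f) := by
  have h1 : (‖cutoffChart f q‖ ^ 2 - 1) ^ 2 = 0 := by
    unfold circleDefect at h
    nlinarith [sq_nonneg (‖cutoffChart f q‖ ^ 2 - 1), sq_nonneg (1 - f q)]
  have h2 : (1 - f q) ^ 2 = 0 := by
    unfold circleDefect at h
    nlinarith [sq_nonneg (‖cutoffChart f q‖ ^ 2 - 1), sq_nonneg (1 - f q)]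
  refine mem_range_smallCircle_of_norm_cutoffChart f ?_ ?_
  · linarith [pow_eq_zero_iff two_ne_zero |>.1 h2]
  · have h3 : ‖cutoffChart f q‖ ^ 2 = 1 := by linarith [pow_eq_zero_iff two_ne_zero |>.1 h1]
    exact (pow_eq_one_iff_of_nonneg (norm_nonneg _) two_ne_zero).1 h3

lemma circleDefect_smallCircle (t : ℝ) : circleDefect f (smallCircle f t) = 0 := by
  simp [circleDefect, cutoffChart_smallCircle, norm_unitCircle, bump_smallCircle]

/-- This is `|θ| ≤ 1` in the dual norm. By Lagrange's identity, `|z|² |ζ₁|²` is the square of the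
form plus the square of the inner product of `z` and `ζ₁`; the defect term only adds to it. -/
lemma sq_circleForm_le (q : S) (ζ : EuclideanSpace ℝ (Fin 2) × EuclideanSpace ℝ (Fin N)) :
    circleForm f N q ζ ^ 2 ≤ circleBilin f N q ζ ζ := by
  have h := mul_nonneg (circleDefect_nonneg f q) (sq_nonneg ‖ζ.2‖)
  rw [circleForm_apply, circleBilin_apply, real_inner_self_eq_norm_sq, real_inner_self_eq_norm_sq]
  have hz : ‖cutoffChart f q‖ ^ 2 * ‖ζ.1‖ ^ 2 =
      (cutoffChart f q 1 * ζ.1 0 - cutoffChart f q 0 * ζ.1 1) ^ 2 +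
      (cutoffChart f q 0 * ζ.1 0 + cutoffChart f q 1 * ζ.1 1) ^ 2 := by
    simp only [EuclideanSpace.norm_sq_eq, Fin.sum_univ_two, Real.norm_eq_abs, sq_abs]
    ring
  rw [hz]
  nlinarith [sq_nonneg (cutoffChart f q 0 * ζ.1 0 + cutoffChart f q 1 * ζ.1 1)]

lemma circleBilin_nonneg (q : S) (ζ : EuclideanSpace ℝ (Fin 2) × EuclideanSpace ℝ (Fin N)) :
    0 ≤ circleBilin f N q ζ ζ :=
  (sq_nonneg _).trans (sq_circleForm_le f q ζ)

/-- With `g ≥ θ²`, the left side completes to `½ (θ + 1)²`. -/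
lemma pullbackLagrangian_circle_nonneg (p : TangentBundle (𝓡 2) S) :
    0 ≤ pullbackLagrangian (circleMap f e) (circleBilin f N) (circleForm f N) p + 1 / 2 := by
  have h := sq_circleForm_le f p.1 (differential (circleMap f e) p.1 p.2)
  unfold pullbackLagrangian
  nlinarith [sq_nonneg (circleForm f N p.1 (differential (circleMap f e) p.1 p.2) + 1)]

variable {e}
variable [IsManifold (𝓡 2) ∞ S]

lemma mfderiv_smallCircle_mem_tangentVectors (t : ℝ) :
    (mfderiv 𝓘(ℝ, ℝ) (𝓡 2) (smallCircle f) t (1 : ℝ) : TangentSpace (𝓡 2) (smallCircle f t)) ∈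
      tangentVectors (range (smallCircle f)) (smallCircle f t) := by
  have hs := contMDiff_smallCircle f
  have hadd : ContMDiff 𝓘(ℝ, ℝ) 𝓘(ℝ, ℝ) ∞ fun s : ℝ => t + s :=
    (contDiff_const.add contDiff_id).contMDiff
  -- Tangent vectors are velocities at time `0`, hence the shift. The base point becomes `t + 0`, so
  -- the final comparison is made in the total space.
  refine ⟨fun s => smallCircle f (t + s), (hs.comp hadd).contMDiffAt,
    Filter.Eventually.of_forall fun s => mem_range_self _, ?_⟩
  have hd : HasMFDerivAt 𝓘(ℝ, ℝ) 𝓘(ℝ, ℝ) (fun s : ℝ => t + s) 0 (ContinuousLinearMap.id ℝ ℝ) :=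
    ((hasFDerivAt_id (0 : ℝ)).const_add t).hasMFDerivAt
  have hc := ((hs.mdifferentiable (by simp) (t + 0)).hasMFDerivAt.comp 0 hd).mfderiv
  have hc' : mfderiv 𝓘(ℝ, ℝ) (𝓡 2) (fun s => smallCircle f (t + s)) 0 (1 : ℝ) =
      mfderiv 𝓘(ℝ, ℝ) (𝓡 2) (smallCircle f) (t + 0) (1 : ℝ) := DFunLike.congr_fun hc (1 : ℝ)
  rw [hc']
  exact congrArg (fun s : ℝ => (⟨smallCircle f s,
    mfderiv 𝓘(ℝ, ℝ) (𝓡 2) (smallCircle f) s (1 : ℝ)⟩ : TangentBundle (𝓡 2) S)) (add_zero t)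

variable [T2Space S]

lemma contMDiff_circleMap (he : ContMDiff (𝓡 2) 𝓘(ℝ, EuclideanSpace ℝ (Fin N)) ∞ e) :
    ContMDiff (𝓡 2) 𝓘(ℝ, EuclideanSpace ℝ (Fin 2) × EuclideanSpace ℝ (Fin N)) ∞
      (circleMap f e) :=
  (contMDiff_cutoffChart f).prodMk_space he

lemma contMDiff_circleForm : ContMDiff (𝓡 2)
    𝓘(ℝ, EuclideanSpace ℝ (Fin 2) × EuclideanSpace ℝ (Fin N) →L[ℝ] ℝ) ∞ (circleForm f N) := by
  have h : ContDiff ℝ ∞ fun z : EuclideanSpace ℝ (Fin 2) =>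
      (z 1) • ((EuclideanSpace.proj (𝕜 := ℝ) (0 : Fin 2)).comp
        (.fst ℝ _ (EuclideanSpace ℝ (Fin N)))) -
      (z 0) • ((EuclideanSpace.proj (𝕜 := ℝ) (1 : Fin 2)).comp (.fst ℝ _ _)) := by
    fun_prop
  exact h.contMDiff.comp (contMDiff_cutoffChart f)

lemma contMDiff_circleDefect_smul_add {V : Type*} [NormedAddCommGroup V] [NormedSpace ℝ V]
    (x y : V) : ContMDiff (𝓡 2) 𝓘(ℝ, V) ∞
      (fun q => ‖cutoffChart f q‖ ^ 2 • x + circleDefect f q • y) := by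
  have hn : ContDiff ℝ ∞ fun z : EuclideanSpace ℝ (Fin 2) × ℝ => ‖z.1‖ ^ 2 :=
    contDiff_fst.norm_sq ℝ
  have hu : ContDiff ℝ ∞ fun z : EuclideanSpace ℝ (Fin 2) × ℝ =>
      (‖z.1‖ ^ 2 - 1) ^ 2 + (1 - z.2) ^ 2 :=
    ((hn.sub contDiff_const).pow 2).add ((contDiff_const.sub contDiff_snd).pow 2)
  have h : ContDiff ℝ ∞ fun z : EuclideanSpace ℝ (Fin 2) × ℝ =>
      ‖z.1‖ ^ 2 • x + ((‖z.1‖ ^ 2 - 1) ^ 2 + (1 - z.2) ^ 2) • y :=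
    (hn.smul contDiff_const).add (hu.smul contDiff_const)
  have hZ : ContMDiff (𝓡 2) 𝓘(ℝ, EuclideanSpace ℝ (Fin 2) × ℝ) ∞
      (fun q => (cutoffChart f q, f q)) :=
    (contMDiff_cutoffChart f).prodMk_space f.contMDiff
  refine (h.contMDiff.comp hZ).congr fun q => ?_
  simp only [Function.comp_apply, circleDefect]

set_option synthInstance.maxHeartbeats 200000 in
lemma contMDiff_circleBilin : ContMDiff (𝓡 2)
    𝓘(ℝ, EuclideanSpace ℝ (Fin 2) × EuclideanSpace ℝ (Fin N) →L[ℝ]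
      EuclideanSpace ℝ (Fin 2) × EuclideanSpace ℝ (Fin N) →L[ℝ] ℝ) ∞ (circleBilin f N) := by
  refine (contMDiff_circleDefect_smul_add f
    (innerComp (.fst ℝ (EuclideanSpace ℝ (Fin 2)) (EuclideanSpace ℝ (Fin N))))
    (innerComp (.snd ℝ (EuclideanSpace ℝ (Fin 2)) (EuclideanSpace ℝ (Fin N))))).congr
    fun q => ?_
  rw [circleBilin]

lemma differential_circleMap (he : ContMDiff (𝓡 2) 𝓘(ℝ, EuclideanSpace ℝ (Fin N)) ∞ e)
    (q : S) (v : TangentSpace (𝓡 2) q) :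
    differential (circleMap f e) q v =
      (differential (cutoffChart f) q v, differential e q v) := by
  have h := mfderiv_prodMk ((contMDiff_cutoffChart f).mdifferentiable (by simp) q)
    (he.mdifferentiable (by simp) q)
  rw [← modelWithCornersSelf_prod, chartedSpaceSelf_prod] at h
  exact DFunLike.congr_fun h v

/-- Where the defect vanishes the point is on the circle, so `|z| = 1` and `dz` is injective;
elsewhere the defect is positive and `de` is injective. -/
lemma circleBilin_pos (he : ContMDiff (𝓡 2) 𝓘(ℝ, EuclideanSpace ℝ (Fin N)) ∞ e)
    (hinj : ∀ q, Function.Injective (differential (n := 2) e q)) (q : S)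
    (v : TangentSpace (𝓡 2) q) (hv : v ≠ 0) :
    0 < circleBilin f N q (differential (circleMap f e) q v)
      (differential (circleMap f e) q v) := by
  rw [circleBilin_apply, differential_circleMap f he, real_inner_self_eq_norm_sq,
    real_inner_self_eq_norm_sq]
  have h1 : 0 ≤ ‖cutoffChart f q‖ ^ 2 * ‖differential (cutoffChart f) q v‖ ^ 2 := by positivity
  rcases (circleDefect_nonneg f q).eq_or_lt with h | h
  · obtain ⟨t, rfl⟩ := mem_range_smallCircle_of_circleDefect_eq_zero f h.symm
    have hne : differential (cutoffChart f) (smallCircle f t) v ≠ 0 :=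
      (map_ne_zero_iff _ (injective_differential_cutoffChart f t)).2 hv
    rw [← h, cutoffChart_smallCircle, norm_unitCircle]
    have := norm_pos_iff.2 hne
    positivity
  · have hne : differential e q v ≠ 0 := (map_ne_zero_iff _ (hinj q)).2 hv
    have := norm_pos_iff.2 hne
    positivity

lemma differential_circleMap_smallCircle
    (he : ContMDiff (𝓡 2) 𝓘(ℝ, EuclideanSpace ℝ (Fin N)) ∞ e) (t : ℝ) :
    (differential (circleMap f e) (smallCircle f t)
      (mfderiv 𝓘(ℝ, ℝ) (𝓡 2) (smallCircle f) t (1 : ℝ))).1 = unitCircleVelocity t := by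
  rw [differential_circleMap f he]
  refine differential_mfderiv_of_hasDerivAt
    ((contMDiff_cutoffChart f).mdifferentiable (by simp) _)
    ((contMDiff_smallCircle f).mdifferentiable (by simp) t) ?_
  simp only [cutoffChart_smallCircle]
  exact hasDerivAt_unitCircle t

lemma circleForm_smallCircle (he : ContMDiff (𝓡 2) 𝓘(ℝ, EuclideanSpace ℝ (Fin N)) ∞ e) (t : ℝ) :
    circleForm f N (smallCircle f t) (differential (circleMap f e) (smallCircle f t)
      (mfderiv 𝓘(ℝ, ℝ) (𝓡 2) (smallCircle f) t (1 : ℝ))) = -1 := by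
  rw [circleForm_apply, differential_circleMap_smallCircle f he, cutoffChart_smallCircle]
  simp
  linarith [Real.sin_sq_add_cos_sq t]

lemma circleBilin_smallCircle (he : ContMDiff (𝓡 2) 𝓘(ℝ, EuclideanSpace ℝ (Fin N)) ∞ e) (t : ℝ) :
    circleBilin f N (smallCircle f t) (differential (circleMap f e) (smallCircle f t)
      (mfderiv 𝓘(ℝ, ℝ) (𝓡 2) (smallCircle f) t (1 : ℝ)))
      (differential (circleMap f e) (smallCircle f t)
      (mfderiv 𝓘(ℝ, ℝ) (𝓡 2) (smallCircle f) t (1 : ℝ))) = 1 := by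
  rw [circleBilin_apply, differential_circleMap_smallCircle f he, cutoffChart_smallCircle,
    circleDefect_smallCircle, norm_unitCircle, real_inner_self_eq_norm_sq,
    norm_unitCircleVelocity]
  simp

/-- No orbit of energy below `½` starts at `smallCircle f` with the conormal condition, whatever
the other boundary manifold. -/
lemma not_satisfiesConormal_smallCircle
    (he : ContMDiff (𝓡 2) 𝓘(ℝ, EuclideanSpace ℝ (Fin N)) ∞ e) {k : ℝ} (hk : k < 1 / 2) {T : ℝ}
    (hT : 0 < T) {γ : ℝ → S} {Q₁ : Set S}
    (hE : HasEnergy (pullbackLagrangian (n := 2) (circleMap f e) (circleBilin f N)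
      (circleForm f N)) T γ k) :
    ¬ SatisfiesConormal (pullbackLagrangian (n := 2) (circleMap f e) (circleBilin f N)
      (circleForm f N)) (range (smallCircle f)) Q₁ T γ := by
  rintro ⟨⟨t, ht⟩, -, hcon, -⟩
  have hE0 := hE 0 (left_mem_Icc.2 hT.le)
  -- The type of the velocity depends on `γ 0`; both are generalized so that `γ 0` can be replaced
  -- by the point of the circle.
  generalize velocity (n := 2) T γ 0 = v at hE0 hcon
  generalize γ 0 = q at ht v hE0 hcon
  subst ht
  exact fiberDeriv_ne_zero_of_energy_lt (circleBilin_symm f) (circleBilin_nonneg f)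
    (circleBilin_smallCircle f he t) (circleForm_smallCircle f he t) (hE0.trans_lt hk)
    (hcon _ (mfderiv_smallCircle_mem_tangentVectors f t))

end CircleLagrangian

end MagneticOrbits

end
theorem proposition3p3p4 {S : Type*} [TopologicalSpace S] [T2Space S] [CompactSpace S]
    [ConnectedSpace S] [ChartedSpace (EuclideanSpace ℝ (Fin 2)) S] [IsManifold (𝓡 2) ∞ S]
    (hS : MagneticOrbits.IsOrientable 2 S) (ε : ℝ) (hε : 0 < ε) :
    ∃ L : TangentBundle (𝓡 2) S → ℝ,
      MagneticOrbits.IsMagneticLagrangian L ∧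
      (∃ c : ℝ, MagneticOrbits.IsManeCriticalValueUniversalCover L c ∧
        c ∈ Set.Icc (1 / 2 - ε) (1 / 2)) ∧
      ∃ Q₀ Q₁ : Set S,
        MagneticOrbits.IsClosedConnectedSubmanifold 2 Q₀ ∧
        MagneticOrbits.IsClosedConnectedSubmanifold 2 Q₁ ∧
        (Q₀ ∩ Q₁).Nonempty ∧
        ∀ k : ℝ, k < 1 / 2 - ε →
          ¬ ∃ (T : ℝ) (γ : ℝ → S), MagneticOrbits.IsEulerLagrangeOrbit L T γ ∧
            MagneticOrbits.HasEnergy L T γ k ∧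
            MagneticOrbits.SatisfiesConormal L Q₀ Q₁ T γ := by
  open MagneticOrbits in
  obtain ⟨q₀⟩ := (inferInstance : Nonempty S)
  -- A Whitney embedding, needed only as an immersion, supplies the background metric.
  obtain ⟨N, e, he, -, hinj⟩ := exists_embedding_euclidean_of_compact (I := 𝓡 2) (M := S)
  let f : SmoothBumpFunction (𝓡 2) q₀ := Classical.arbitrary _
  have hQ := isClosedConnectedSubmanifold_range_smallCircle f
  refine ⟨pullbackLagrangian (circleMap f e) (circleBilin f N) (circleForm f N),
    isMagneticLagrangian_pullbackLagrangian (contMDiff_circleMap f he) (contMDiff_circleBilin f)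
      (circleBilin_symm f) (circleBilin_pos f he hinj) (contMDiff_circleForm f),
    ⟨1 / 2, isManeCriticalValueUniversalCover_half (pullbackLagrangian_circle_nonneg f e)
      (contMDiff_smallCircle f) Real.two_pi_pos (isContractibleLoop_smallCircle f) fun t => ?_,
      by linarith, le_rfl⟩,
    range (smallCircle f), range (smallCircle f), hQ, hQ, ?_, ?_⟩
  · rw [pullbackLagrangian, circleBilin_smallCircle f he t, circleForm_smallCircle f he t]
    norm_num
  · rw [inter_self]
    exact range_nonempty _
  · rintro k hk ⟨T, γ, ⟨hT, -⟩, hE, hcon⟩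
    exact not_satisfiesConormal_smallCircle f he (by linarith) hT hE hcon
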